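/- Let $G$ be a split connected reductive group over a complete discretely valued field $L$ with algebraically closed residue field. Let $S$ be a split maximal torus of $G$, with reduced root datum $(X^*(S),R,X_*(S),R^\vee)$, finite Weyl group $W$ and coroot lattice $Q^\vee\subset X_*(S)$. Let $\tilde W=N(L)/T(L)_1=X_*(S)\rtimes W$ (where $T=S$, $N$ is the normalizer of $T$ and $T(L)_1$ is the kernel of the valuation map $T(L)\to X_*(S)$) be the Iwahori–Weyl group, and let $W_a=Q^\vee\rtimes W$ be the affine Weyl group, i.e. the kernel of the Kottwitz homomorphism $\tilde W\to X_*(S)/Q^\vee$. The group $\tilde W$ acts on the apartment $X_*(S_{ad})_{\mathbb R}=\operatorname{Hom}(\mathbb ZR,\mathbb R)$, whose affine root hyperplanes are $\alpha=m$ ($\alpha\in R$, $m\in\mathbb Z$); the translation element $t_\nu$ acts as $v\mapsto v+\nu$. Fix an alcove $\mathbf a$. It defines the length $\ell(w)$ (the number of affine root hyperplanes separating $\mathbf a$ from $w\mathbf a$) and the Bruhat order on $\tilde W$, generated by the relations $sy<y$ for $s$ an affine reflection with $\ell(sy)<\ell(y)$. Let $x$ be a special vertex of $\mathbf a$, let $K$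 be the corresponding special maximal parahoric subgroup, and let $\tilde W^K=(N(L)\cap K)/T(L)_1=\{w\in W_a : w(x)=x\}$. For $c,d\in\tilde W^K\backslash\tilde W/\tilde W^K$ write $c\le d$ if some representative of $c$ is $\le$ some representative of $d$ in the Bruhat order. Fix an ordering of the roots, let $\mu\in X_*(S)$ be dominant, let $\Lambda=W\mu$, and let $\mathcal P_\mu$ be the convex hull of the image of $\Lambda$ in $X_*(S_{ad})_{\mathbb R}$. Put $$\mathrm{Adm}_K(\mu)=\{c : c\le \tilde W^K t_\lambda\tilde W^K\text{ for some }\lambda\in\Lambda\},$$ $$\mathrm{Perm}_K(\mu)=\{\tilde W^Kw\tilde W^K : w\equiv t_\mu \bmod W_a,\ w(x)-x\in\mathcal P_\mu\}.$$ Then $\nu\mapsto\tilde W^Kt_\nu\tilde W^K$ is a bijection from the set of dominant elements of $X_*(S)$ onto $\tilde W^K\backslash\tilde W/\tilde W^K$, and under this identification $$\mathrm{Adm}_K(\mu)=\mathrm{Perm}_K(\mu)=\{\nu\in X_*(S)\text{ dominant} : \nu\le\mu\},$$ where $\nu\le\mu$ means that $\mu-\nu$ is a sum of simple coroots with nonnegative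 integer coefficients. In particular, if $\mu$ is minuscule, i.e. $\langle\alpha,\mu\rangle\in\{-1,0,1\}$ for all $\alpha\in R$, then $\mathrm{Adm}_K(\mu)$ consists of the single element $\mu$. -/

import Mathlib

/-!
Combinatorics of the Iwahori-Weyl group of a split connected reductive group `G` over a complete
discretely valued field `L` with algebraically closed residue field.

Such a group, with its split maximal torus `S = T`, is given by its reduced root datum
`P : RootDatum ι X Y`, where `X = X^*(S)` and `Y = X_*(S)`.  The finite Weyl group
`W_0 = W = N(L)/T(L)` is `P.weylGroup`, and the Galois action on `X_*(T)` is trivial.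
-/

namespace IwahoriWeyl

noncomputable section

variable {ι X Y : Type*} [AddCommGroup X] [AddCommGroup Y]

/-! ### The Iwahori-Weyl group -/

/-- The action of the Weyl group on the cocharacter lattice.  (`coweightMap` is contravariant in
Mathlib, whence the inverse; the reflection in the `i`-th root acts through `P.coreflection i`.) -/
def weylAct (P : RootPairing ι ℤ X Y) : P.weylGroup →* MulAut (Multiplicative Y) where
  toFun w := AddEquiv.toMultiplicative
    (RootPairing.Equiv.coweightEquiv P P (w : P.Aut)⁻¹).toAddEquiv
  map_one' := by
    ext y
    simp
  map_mul' w w' := by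
    ext y
    simp

/-- `w ν`, for `w` in the Weyl group and `ν` a cocharacter. -/
def weylSmul (P : RootPairing ι ℤ X Y) (w : P.weylGroup) (ν : Y) : Y :=
  (weylAct P w (Multiplicative.ofAdd ν)).toAdd

/-- The Iwahori-Weyl group `N(L)/T(L)₁ = X_*(S) ⋊ W` of the split group: the translation
subgroup is `T(L)/T(L)₁ = X_*(S)`.  The element `⟨ν, w⟩` is `t_ν w`. -/
abbrev ExtAffineWeyl (P : RootPairing ι ℤ X Y) : Type _ :=
  Multiplicative Y ⋊[weylAct P] P.weylGroup

/-- The translation element `t_ν`. -/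
def transl (P : RootPairing ι ℤ X Y) (ν : Y) : ExtAffineWeyl P :=
  SemidirectProduct.inl (Multiplicative.ofAdd ν)

lemma weylSmul_ofIdx (P : RootPairing ι ℤ X Y) (i : ι) (ν : Y) :
    weylSmul P (RootPairing.weylGroup.ofIdx P i) ν = ν - P.toLinearMap (P.root i) ν • P.coroot i := by
  simp [weylSmul, weylAct, RootPairing.weylGroup.ofIdx]
  rfl

lemma weylSmul_sub_mem (P : RootPairing ι ℤ X Y) (w : P.weylGroup) (ν : Y) :
    weylSmul P w ν - ν ∈ P.corootSpan ℤ := by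
  obtain ⟨w, hw⟩ := w
  induction hw using RootPairing.weylGroup.induction generalizing ν with
  | mem i =>
    have h := weylSmul_ofIdx P i ν
    unfold RootPairing.weylGroup.ofIdx at h
    rw [h]
    have : ν - P.toLinearMap (P.root i) ν • P.coroot i - ν
        = -(P.toLinearMap (P.root i) ν • P.coroot i) := by abel
    rw [this]
    exact Submodule.neg_mem _ (Submodule.smul_mem _ _ (Submodule.subset_span ⟨i, rfl⟩))
  | one =>
    have : weylSmul P (1 : P.weylGroup) ν = ν := by simp [weylSmul]
    change weylSmul P (1 : P.weylGroup) ν - ν ∈ _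
    simp [this]
  | mul x y hx hy ihx ihy =>
    have : weylSmul P (⟨x, hx⟩ * ⟨y, hy⟩ : P.weylGroup) ν
        = weylSmul P ⟨x, hx⟩ (weylSmul P ⟨y, hy⟩ ν) := by
      unfold weylSmul
      rw [map_mul]
      rfl
    change weylSmul P (⟨x, hx⟩ * ⟨y, hy⟩ : P.weylGroup) ν - ν ∈ _
    rw [this]
    have h := Submodule.add_mem _ (ihx (weylSmul P ⟨y, hy⟩ ν)) (ihy ν)
    simpa using h

/-- The affine Weyl group `W_a = Q^∨ ⋊ W`, where `Q^∨ = X_*(S_sc)` is the coroot lattice.  It is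
the kernel of the Kottwitz homomorphism `ExtAffineWeyl P → X_*(S) / Q^∨`, `t_ν w ↦ ν + Q^∨`. -/
def affineWeyl (P : RootPairing ι ℤ X Y) : Subgroup (ExtAffineWeyl P) where
  carrier := {x | x.left.toAdd ∈ P.corootSpan ℤ}
  one_mem' := by simp
  mul_mem' {x y} hx hy := by
    have h := Submodule.add_mem _ hx
      (Submodule.add_mem _ (weylSmul_sub_mem P x.right y.left.toAdd) hy)
    simpa [weylSmul] using h
  inv_mem' {x} hx := by
    have h := Submodule.sub_mem _ (weylSmul_sub_mem P x.right⁻¹ (-x.left.toAdd)) hx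
    simpa [weylSmul, sub_eq_add_neg] using h

/-! ### The apartment, alcoves and facets -/

/-- The apartment `X_*(S_ad)_ℝ`: real-valued linear forms on the root lattice `X^*(S_ad)`, with
origin a hyperspecial point. -/
abbrev Apartment (P : RootPairing ι ℤ X Y) : Type _ := P.rootSpan ℤ →ₗ[ℤ] ℝ

/-- The value `α_i(v)` of the `i`-th root at a point of the apartment. -/
def rootVal (P : RootPairing ι ℤ X Y) (i : ι) (v : Apartment P) : ℝ :=
  v ⟨P.root i, Submodule.subset_span ⟨i, rfl⟩⟩

/-- The natural map `X_*(S) → X_*(S_ad)_ℝ`. -/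
def toApartment (P : RootPairing ι ℤ X Y) (ν : Y) : Apartment P :=
  (Int.castAddHom ℝ).toIntLinearMap ∘ₗ P.toLinearMap.flip ν ∘ₗ (P.rootSpan ℤ).subtype

lemma weightMap_mem (P : RootPairing ι ℤ X Y) (w : P.Aut) :
    ∀ q ∈ P.rootSpan ℤ, w.weightMap q ∈ P.rootSpan ℤ := by
  intro q hq
  induction hq using Submodule.span_induction with
  | mem q hq =>
    obtain ⟨i, rfl⟩ := hq
    rw [RootPairing.Hom.root_weightMap_apply]
    exact Submodule.subset_span ⟨_, rfl⟩
  | zero => simp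
  | add a b _ _ ha hb => simpa using Submodule.add_mem _ ha hb
  | smul c a _ ha => simpa using Submodule.smul_mem _ c ha

/-- The action of the Iwahori-Weyl group on the apartment: `t_ν w` sends `v` to `w(v) + ν`, where
`w(v) = v ∘ w⁻¹`. -/
def act (P : RootPairing ι ℤ X Y) (x : ExtAffineWeyl P) (v : Apartment P) : Apartment P :=
  v ∘ₗ ((x.right : P.Aut)⁻¹).weightMap.restrict (weightMap_mem P _)
    + toApartment P x.left.toAdd

lemma act_one (P : RootPairing ι ℤ X Y) (v : Apartment P) : act P 1 v = v := by
  ext q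
  simp [act, toApartment]
  rfl

lemma act_mul (P : RootPairing ι ℤ X Y) (x y : ExtAffineWeyl P) (v : Apartment P) :
    act P (x * y) v = act P x (act P y v) := by
  have key : ∀ (w : P.weylGroup) (ν : Y) (q : X),
      P.toLinearMap q (weylSmul P w ν) = P.toLinearMap (((w : P.Aut)⁻¹).weightMap q) ν :=
    fun w ν q => (LinearMap.congr_fun
      (LinearMap.congr_fun ((w : P.Aut)⁻¹).weight_coweight_transpose ν) q).symm
  have hr : ∀ q : P.rootSpan ℤ,
      (((x * y).right : P.Aut)⁻¹).weightMap.restrict (weightMap_mem P _) q =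
        ((y.right : P.Aut)⁻¹).weightMap.restrict (weightMap_mem P _)
          (((x.right : P.Aut)⁻¹).weightMap.restrict (weightMap_mem P _) q) := by
    intro q
    have h : (((x * y).right : P.Aut)⁻¹) = (y.right : P.Aut)⁻¹ * (x.right : P.Aut)⁻¹ :=
      mul_inv_rev _ _
    apply Subtype.ext
    change (((x * y).right : P.Aut)⁻¹).weightMap q = _
    rw [h]
    rfl
  have hl : (x * y).left.toAdd = x.left.toAdd + weylSmul P x.right y.left.toAdd := rfl
  refine LinearMap.ext fun q => ?_
  have h := key x.right y.left.toAdd q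
  change v ((((x * y).right : P.Aut)⁻¹).weightMap.restrict (weightMap_mem P _) q)
      + ((P.toLinearMap q (x * y).left.toAdd : ℤ) : ℝ)
    = (v (((y.right : P.Aut)⁻¹).weightMap.restrict (weightMap_mem P _)
          (((x.right : P.Aut)⁻¹).weightMap.restrict (weightMap_mem P _) q))
        + ((P.toLinearMap (((x.right : P.Aut)⁻¹).weightMap q) y.left.toAdd : ℤ) : ℝ))
      + ((P.toLinearMap q x.left.toAdd : ℤ) : ℝ)
  rw [hr, hl, map_add, h]
  push_cast
  ring

lemma rootVal_toApartment (P : RootPairing ι ℤ X Y) (i : ι) (ν : Y) :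
    rootVal P i (toApartment P ν) = (P.toLinearMap (P.root i) ν : ℝ) := by
  simp [rootVal, toApartment]

/-- The affine reflection `v ↦ v - (α_i(v) - m) α_i^∨` in the hyperplane `α_i = m`, as an element
`t_{m α_i^∨} s_i` of the affine Weyl group. -/
def affineReflection (P : RootPairing ι ℤ X Y) (i : ι) (m : ℤ) : ExtAffineWeyl P :=
  ⟨Multiplicative.ofAdd (m • P.coroot i), RootPairing.weylGroup.ofIdx P i⟩

/-- The facet through the point `v`: all points on the same side of every affine root hyperplane
`α_i = m`. -/
def facet (P : RootPairing ι ℤ X Y) (v : Apartment P) : Set (Apartment P) :=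
  {u | ∀ (i : ι) (m : ℤ),
    (rootVal P i u < m ↔ rootVal P i v < m) ∧ (rootVal P i u = m ↔ rootVal P i v = m)}

/-- An (open) alcove: the facet of a point that lies on no affine root hyperplane. -/
def IsAlcove (P : RootPairing ι ℤ X Y) (a : Set (Apartment P)) : Prop :=
  ∃ v, (∀ (i : ι) (m : ℤ), rootVal P i v ≠ m) ∧ a = facet P v

/-- The closure of an alcove `a`: the intersection of the closed affine root half-spaces that
contain `a`. -/
def closedAlcove (P : RootPairing ι ℤ X Y) (a : Set (Apartment P)) : Set (Apartment P) :=
  {u | ∀ (i : ι) (m : ℤ), (∀ v ∈ a, rootVal P i v ≤ m) → rootVal P i u ≤ m}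

/-- A special vertex: a point which, for every root, lies on an affine root hyperplane parallel
to the kernel of that root. -/
def IsSpecial (P : RootPairing ι ℤ X Y) (x : Apartment P) : Prop :=
  ∀ i : ι, ∃ m : ℤ, rootVal P i x = m

/-! ### Length and Bruhat order -/

/-- The length of `x` relative to the alcove `a`: the number of affine root hyperplanes that
separate `a` from `x a`.  (Each of them is counted once, through the affine root `α_i - m` that is
negative on `a` and positive on `x a`.) -/
def length (P : RootPairing ι ℤ X Y) (a : Set (Apartment P)) (x : ExtAffineWeyl P) : ℕ :=
  Set.ncard {p : ι × ℤ |
    (∀ v ∈ a, rootVal P p.1 v < p.2) ∧ ∀ v ∈ a, (p.2 : ℝ) < rootVal P p.1 (act P x v)}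

/-- The Bruhat order on the Iwahori-Weyl group defined by the alcove `a`: the partial order
generated by the relations `s y < y`, for `s` an affine reflection with `ℓ(s y) < ℓ(y)`.
Comparable elements have the same component in `Ω`. -/
def BruhatLE (P : RootPairing ι ℤ X Y) (a : Set (Apartment P)) (x y : ExtAffineWeyl P) : Prop :=
  Relation.ReflTransGen
    (fun x y => (∃ i m, x = affineReflection P i m * y) ∧ length P a x < length P a y) x y

/-! ### Parahoric subgroups and double cosets -/

/-- `W̃^K = (N(L) ∩ K) / T(L)₁` for the parahoric subgroup `K = Fix(F) ∩ ker κ` attached to a facet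
`F`: the elements of the Iwahori-Weyl group in the kernel `W_a` of the Kottwitz homomorphism that
fix `F` pointwise. -/
def parahoricWeyl (P : RootPairing ι ℤ X Y) (F : Set (Apartment P)) :
    Subgroup (ExtAffineWeyl P) where
  carrier := {x | x ∈ affineWeyl P ∧ ∀ v ∈ F, act P x v = v}
  one_mem' := ⟨one_mem _, fun v _ => act_one P v⟩
  mul_mem' {x y} hx hy :=
    ⟨mul_mem hx.1 hy.1, fun v hv => by rw [act_mul, hy.2 v hv, hx.2 v hv]⟩
  inv_mem' {x} hx := by
    refine ⟨inv_mem hx.1, fun v hv => ?_⟩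
    conv_lhs => rw [← hx.2 v hv]
    rw [← act_mul, inv_mul_cancel, act_one]

/-- The double coset space `W̃^K \ W̃ / W̃^K`. -/
abbrev DoubleCosets (P : RootPairing ι ℤ X Y) (F : Set (Apartment P)) : Type _ :=
  DoubleCoset.Quotient (parahoricWeyl P F : Set (ExtAffineWeyl P)) (parahoricWeyl P F)

/-- The double coset of `x`. -/
def toDoubleCoset (P : RootPairing ι ℤ X Y) (F : Set (Apartment P)) (x : ExtAffineWeyl P) :
    DoubleCosets P F :=
  DoubleCoset.mk (parahoricWeyl P F) (parahoricWeyl P F) x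

/-- The Bruhat order on `W̃^K \ W̃ / W̃^K`: some representatives are comparable. -/
def DoubleCosetLE (P : RootPairing ι ℤ X Y) (a F : Set (Apartment P)) (c d : DoubleCosets P F) :
    Prop :=
  ∃ x y, toDoubleCoset P F x = c ∧ toDoubleCoset P F y = d ∧ BruhatLE P a x y

/-! ### Admissible and permissible sets -/

/-- The Weyl group orbit `Λ` of `μ`. -/
def weylOrbit (P : RootPairing ι ℤ X Y) (μ : Y) : Set Y :=
  {ν | ∃ w : P.weylGroup, ν = weylSmul P w μ}

/-- `Adm_K(μ)`: the double cosets below the double coset of `t_ν` for some `ν ∈ Λ`. -/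
def Adm (P : RootPairing ι ℤ X Y) (a F : Set (Apartment P)) (μ : Y) : Set (DoubleCosets P F) :=
  {c | ∃ ν ∈ weylOrbit P μ, DoubleCosetLE P a F c (toDoubleCoset P F (transl P ν))}

/-- `P_μ`: the convex hull of the image of `Λ` in `X_*(S_ad)_ℝ`. -/
def orbitHull (P : RootPairing ι ℤ X Y) (μ : Y) : Set (Apartment P) :=
  convexHull ℝ (toApartment P '' weylOrbit P μ)

/-- `Perm_K(μ)`: the double cosets of the `x` with `x ≡ t_μ` modulo `W_a` and `x(v) - v ∈ P_μ` for
all `v ∈ F`.  (These conditions depend only on the double coset of `x`.) -/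
def Perm (P : RootPairing ι ℤ X Y) (F : Set (Apartment P)) (μ : Y) : Set (DoubleCosets P F) :=
  {c | ∃ x, toDoubleCoset P F x = c ∧ x * (transl P μ)⁻¹ ∈ affineWeyl P ∧
    ∀ v ∈ F, act P x v - v ∈ orbitHull P μ}

/-! ### Dominant and minuscule coweights -/

/-- `ν` is dominant for the ordering of the roots with simple roots `b`. -/
def IsDominant (P : RootPairing ι ℤ X Y) (b : P.Base) (ν : Y) : Prop :=
  ∀ i ∈ b.support, 0 ≤ P.toLinearMap (P.root i) ν

/-- `ν ≤ μ`: the difference `μ - ν` is a sum of simple coroots with nonnegative integer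
coefficients. -/
def DominanceLE (P : RootPairing ι ℤ X Y) (b : P.Base) (ν μ : Y) : Prop :=
  μ - ν ∈ AddSubmonoid.closure (P.coroot '' b.support)

/-- `μ` is minuscule: `⟨α, μ⟩ ∈ {-1, 0, 1}` for all roots `α`. -/
def IsMinuscule (P : RootPairing ι ℤ X Y) (μ : Y) : Prop :=
  ∀ i : ι, P.toLinearMap (P.root i) μ ∈ ({-1, 0, 1} : Set ℤ)

end

end IwahoriWeyl

namespace IwahoriWeyl

noncomputable section

variable {ι X Y : Type*} [AddCommGroup X] [AddCommGroup Y]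

/-! ### The Weyl group action -/

/-! Since `x` is special, its stabilizer `W̃^K` projects onto the finite Weyl group `W`; it contains
no nonzero translation because the coroot form is positive definite on the coroot lattice. So every
element is `t_ν k` with `k ∈ W̃^K`, and double cosets are `W`-orbits of cocharacters. Each orbit has
exactly one dominant member, uniqueness coming from `w μ ≤ μ` for dominant `μ`
(`weylSmul_dominanceLE`).

Upper bound for `Adm`: a reflection in `α = m` shortens `t_ν k` only if its hyperplane separates the
base alcove from its image. In the closures, `m` lies between `α(x)` and `α(x) + ⟨α, ν⟩`, so the new
translation part lies on the root string from `ν` to `s_α ν`. Such a move preserves the condition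
that all `W`-conjugates are `≤ μ` (`weylSmul_sub_zsmul_coroot_dominanceLE`). For `Perm` the bound
follows by evaluating fundamental weights on the convex hull.

Lower bounds: a dominant `ν ≤ μ` is reached from `μ` by subtracting simple coroots, each from an
element on which its root is positive (`IsDominant.descending_induction`). After a suitable
conjugation every step is a length-decreasing reflection; every step also stays in the hull of the
orbit; and for minuscule `μ` it stays in the orbit itself. -/

lemma root_smul (P : RootPairing ι ℤ X Y) (w : P.weylGroup) (i : ι) :
    P.root (w • i) = (w : P.Aut).weightMap (P.root i) :=
  (RootPairing.Hom.root_weightMap_apply P P i (w : P.Aut).toHom).symm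

lemma weylSmul_neg (P : RootPairing ι ℤ X Y) (w : P.weylGroup) (ν : Y) :
    weylSmul P w (-ν) = -weylSmul P w ν := by
  simp [weylSmul]

lemma weylSmul_sub (P : RootPairing ι ℤ X Y) (w : P.weylGroup) (ν ν' : Y) :
    weylSmul P w (ν - ν') = weylSmul P w ν - weylSmul P w ν' := by
  simp [weylSmul]

lemma weylSmul_zsmul (P : RootPairing ι ℤ X Y) (w : P.weylGroup) (n : ℤ) (ν : Y) :
    weylSmul P w (n • ν) = n • weylSmul P w ν := by
  simp [weylSmul]

lemma weylSmul_one (P : RootPairing ι ℤ X Y) (ν : Y) : weylSmul P 1 ν = ν := by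
  simp [weylSmul]

lemma weylSmul_mul (P : RootPairing ι ℤ X Y) (w w' : P.weylGroup) (ν : Y) :
    weylSmul P (w * w') ν = weylSmul P w (weylSmul P w' ν) := by
  unfold weylSmul
  rw [map_mul]
  rfl

lemma weylSmul_inv_weylSmul (P : RootPairing ι ℤ X Y) (w : P.weylGroup) (ν : Y) :
    weylSmul P w⁻¹ (weylSmul P w ν) = ν := by
  rw [← weylSmul_mul, inv_mul_cancel, weylSmul_one]

lemma weylSmul_weylSmul_inv (P : RootPairing ι ℤ X Y) (w : P.weylGroup) (ν : Y) :
    weylSmul P w (weylSmul P w⁻¹ ν) = ν := by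
  rw [← weylSmul_mul, mul_inv_cancel, weylSmul_one]

lemma toLinearMap_weylSmul (P : RootPairing ι ℤ X Y) (w : P.weylGroup) (q : X) (ν : Y) :
    P.toLinearMap q (weylSmul P w ν) = P.toLinearMap (((w : P.Aut)⁻¹).weightMap q) ν :=
  (LinearMap.congr_fun
      (LinearMap.congr_fun ((w : P.Aut)⁻¹).weight_coweight_transpose ν) q).symm

lemma toLinearMap_root_weylSmul (P : RootPairing ι ℤ X Y) (w : P.weylGroup) (i : ι) (ν : Y) :
    P.toLinearMap (P.root i) (weylSmul P w ν) = P.toLinearMap (P.root (w⁻¹ • i)) ν := by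
  rw [toLinearMap_weylSmul, root_smul]
  rfl

lemma toLinearMap_root_smul (P : RootPairing ι ℤ X Y) (w : P.weylGroup) (i : ι) (ν : Y) :
    P.toLinearMap (P.root (w • i)) (weylSmul P w ν) = P.toLinearMap (P.root i) ν := by
  rw [toLinearMap_root_weylSmul, inv_smul_smul]

lemma weylSmul_coroot (P : RootPairing ι ℤ X Y) (w : P.weylGroup) (i : ι) :
    weylSmul P w (P.coroot i) = P.coroot (w • i) := by
  have h := RootPairing.Hom.coroot_coweightMap_apply P P i ((w : P.Aut)⁻¹).toHom
  exact h

lemma ofIdx_smul_eq (P : RootPairing ι ℤ X Y) (i j : ι) :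
    RootPairing.weylGroup.ofIdx P i • j = P.reflectionPerm i j := rfl

/-- Automorphisms of the root pairing act faithfully on cocharacters, so the two sides are compared
there. -/
lemma ofIdx_smul (P : RootPairing ι ℤ X Y) (w : P.weylGroup) (i : ι) :
    RootPairing.weylGroup.ofIdx P (w • i) = w * RootPairing.weylGroup.ofIdx P i * w⁻¹ := by
  apply Subtype.ext
  apply RootPairing.Equiv.coweightHom_injective
  apply MulOpposite.unop_injective
  refine LinearEquiv.ext fun ν => ?_
  have key : ∀ (u : P.weylGroup) (ν : Y),
      (RootPairing.Equiv.coweightHom P (u : P.Aut)).unop ν = weylSmul P u⁻¹ ν := by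
    intro u ν
    simp only [weylSmul, weylAct]
    simp
  rw [key, key]
  have hinv : ∀ k, (RootPairing.weylGroup.ofIdx P k)⁻¹ = RootPairing.weylGroup.ofIdx P k :=
    fun k => Subtype.ext (RootPairing.Equiv.reflection_inv P k)
  rw [hinv, mul_inv_rev, mul_inv_rev, hinv, inv_inv, weylSmul_mul, weylSmul_mul,
    weylSmul_ofIdx, weylSmul_ofIdx, weylSmul_sub, weylSmul_zsmul, weylSmul_coroot,
    weylSmul_weylSmul_inv]
  congr 2
  rw [toLinearMap_root_weylSmul, inv_inv]

lemma ofIdx_mul_self (P : RootPairing ι ℤ X Y) (i : ι) :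
    RootPairing.weylGroup.ofIdx P i * RootPairing.weylGroup.ofIdx P i = 1 :=
  mul_eq_one_iff_eq_inv.mpr (Subtype.ext (RootPairing.Equiv.reflection_inv P i).symm)

lemma ofIdx_inv (P : RootPairing ι ℤ X Y) (i : ι) :
    (RootPairing.weylGroup.ofIdx P i)⁻¹ = RootPairing.weylGroup.ofIdx P i :=
  Subtype.ext (RootPairing.Equiv.reflection_inv P i)

lemma ofIdx_reflectionPerm_self (P : RootPairing ι ℤ X Y) (i : ι) :
    RootPairing.weylGroup.ofIdx P (P.reflectionPerm i i) = RootPairing.weylGroup.ofIdx P i := by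
  rw [← ofIdx_smul_eq, ofIdx_smul, ofIdx_mul_self, one_mul, ofIdx_inv]

lemma affineReflection_reflectionPerm_self (P : RootPairing ι ℤ X Y) (i : ι) (m : ℤ) :
    affineReflection P (P.reflectionPerm i i) (-m) = affineReflection P i m := by
  unfold affineReflection
  rw [ofIdx_reflectionPerm_self]
  simp

/-! ### Coordinates on the apartment -/

lemma apartment_ext (P : RootPairing ι ℤ X Y) {u v : Apartment P}
    (h : ∀ i, rootVal P i u = rootVal P i v) : u = v := by
  refine LinearMap.ext fun ⟨q, hq⟩ => ?_
  induction hq using Submodule.span_induction with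
  | mem q hq => obtain ⟨i, rfl⟩ := hq; exact h i
  | zero =>
    have h0 : (⟨0, Submodule.zero_mem _⟩ : P.rootSpan ℤ) = 0 := rfl
    simp [h0]
  | add a b ha hb iha ihb =>
    have h0 : (⟨a + b, Submodule.add_mem _ ha hb⟩ : P.rootSpan ℤ) = ⟨a, ha⟩ + ⟨b, hb⟩ := rfl
    rw [h0, map_add, map_add, iha, ihb]
  | smul c a ha iha =>
    have h0 : (⟨c • a, Submodule.smul_mem _ c ha⟩ : P.rootSpan ℤ) = c • ⟨a, ha⟩ := rfl
    rw [h0, map_smul, map_smul, iha]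

lemma rootVal_add (P : RootPairing ι ℤ X Y) (i : ι) (u v : Apartment P) :
    rootVal P i (u + v) = rootVal P i u + rootVal P i v := rfl

lemma rootVal_sub (P : RootPairing ι ℤ X Y) (i : ι) (u v : Apartment P) :
    rootVal P i (u - v) = rootVal P i u - rootVal P i v := rfl

lemma rootVal_smul (P : RootPairing ι ℤ X Y) (i : ι) (c : ℝ) (v : Apartment P) :
    rootVal P i (c • v) = c * rootVal P i v := rfl

lemma rootVal_reflectionPerm (P : RootPairing ι ℤ X Y) (i j : ι) (v : Apartment P) :
    rootVal P (P.reflectionPerm i j) v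
      = rootVal P j v - (P.pairing j i : ℝ) * rootVal P i v := by
  unfold rootVal
  have h : (⟨P.root (P.reflectionPerm i j), Submodule.subset_span ⟨_, rfl⟩⟩ : P.rootSpan ℤ)
      = ⟨P.root j, Submodule.subset_span ⟨_, rfl⟩⟩
        - P.pairing j i • ⟨P.root i, Submodule.subset_span ⟨_, rfl⟩⟩ := by
    apply Subtype.ext
    change P.root (P.reflectionPerm i j) = P.root j - P.pairing j i • P.root i
    rw [RootPairing.root_reflectionPerm, RootPairing.reflection_apply_root]
  rw [h, map_sub, map_smul]
  simp

lemma rootVal_reflectionPerm_self (P : RootPairing ι ℤ X Y) (i : ι) (v : Apartment P) :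
    rootVal P (P.reflectionPerm i i) v = -rootVal P i v := by
  rw [rootVal_reflectionPerm, RootPairing.pairing_same]
  push_cast
  ring

lemma toApartment_add (P : RootPairing ι ℤ X Y) (ν ν' : Y) :
    toApartment P (ν + ν') = toApartment P ν + toApartment P ν' := by
  refine apartment_ext P fun i => ?_
  simp [rootVal_add, rootVal_toApartment]

lemma toApartment_sub (P : RootPairing ι ℤ X Y) (ν ν' : Y) :
    toApartment P (ν - ν') = toApartment P ν - toApartment P ν' := by
  refine apartment_ext P fun i => ?_
  simp [rootVal_sub, rootVal_toApartment]

lemma toApartment_zsmul (P : RootPairing ι ℤ X Y) (n : ℤ) (ν : Y) :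
    toApartment P (n • ν) = (n : ℝ) • toApartment P ν := by
  refine apartment_ext P fun i => ?_
  simp [rootVal_smul, rootVal_toApartment]

lemma rootVal_act (P : RootPairing ι ℤ X Y) (y : ExtAffineWeyl P) (i : ι) (v : Apartment P) :
    rootVal P i (act P y v)
      = rootVal P (y.right⁻¹ • i) v + (P.toLinearMap (P.root i) y.left.toAdd : ℝ) := by
  rw [act, rootVal_add, rootVal_toApartment]
  congr 1
  unfold rootVal
  rw [LinearMap.comp_apply]
  congr 1
  apply Subtype.ext
  exact (root_smul P y.right⁻¹ i).symm

lemma rootVal_act_affineReflection (P : RootPairing ι ℤ X Y) (i : ι) (m : ℤ) (j : ι)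
    (v : Apartment P) :
    rootVal P j (act P (affineReflection P i m) v)
      = rootVal P j v - (P.pairing j i : ℝ) * (rootVal P i v - m) := by
  rw [rootVal_act]
  simp only [affineReflection, ofIdx_inv, ofIdx_smul_eq, rootVal_reflectionPerm, toAdd_ofAdd,
    map_smul, RootPairing.root_coroot_eq_pairing, smul_eq_mul]
  push_cast
  ring

lemma act_inr_toApartment (P : RootPairing ι ℤ X Y) (w : P.weylGroup) (ν : Y) :
    act P (SemidirectProduct.inr w) (toApartment P ν) = toApartment P (weylSmul P w ν) := by
  refine apartment_ext P fun i => ?_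
  rw [rootVal_act, rootVal_toApartment, rootVal_toApartment, toLinearMap_root_weylSmul]
  simp

/-! ### Positive coroots and the dominance order -/

lemma mem_closure_coroot_iff (P : RootPairing ι ℤ X Y) (b : P.Base) (v : Y) :
    v ∈ AddSubmonoid.closure (P.coroot '' b.support) ↔
      ∃ k : ι → ℕ, v = ∑ j ∈ b.support, k j • P.coroot j := by
  classical
  constructor
  · intro hv
    induction hv using AddSubmonoid.closure_induction with
    | mem v hv =>
      obtain ⟨j, hj, rfl⟩ := hv
      have hj' : j ∈ b.support := hj
      refine ⟨Pi.single j 1, ?_⟩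
      rw [Finset.sum_eq_single_of_mem j hj' (fun i _ hij => by simp [hij])]
      simp
    | zero => exact ⟨0, by simp⟩
    | add u v _ _ hu hv =>
      obtain ⟨k, rfl⟩ := hu
      obtain ⟨l, rfl⟩ := hv
      exact ⟨k + l, by simp [add_smul, Finset.sum_add_distrib]⟩
  · rintro ⟨k, rfl⟩
    exact sum_mem fun j hj => nsmul_mem (AddSubmonoid.subset_closure (Set.mem_image_of_mem _ hj)) _

lemma mem_corootSpan_iff (P : RootPairing ι ℤ X Y) (b : P.Base) (v : Y) :
    v ∈ P.corootSpan ℤ ↔ ∃ k : ι → ℤ, v = ∑ j ∈ b.support, k j • P.coroot j := by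
  classical
  rw [← b.span_coroot_support]
  constructor
  · intro hv
    induction hv using Submodule.span_induction with
    | mem v hv =>
      obtain ⟨j, hj, rfl⟩ := hv
      have hj' : j ∈ b.support := hj
      refine ⟨Pi.single j 1, ?_⟩
      rw [Finset.sum_eq_single_of_mem j hj' (fun i _ hij => by simp [hij])]
      simp
    | zero => exact ⟨0, by simp⟩
    | add u v _ _ hu hv =>
      obtain ⟨k, rfl⟩ := hu
      obtain ⟨l, rfl⟩ := hv
      exact ⟨k + l, by simp [add_smul, Finset.sum_add_distrib]⟩
    | smul c u _ hu =>
      obtain ⟨k, rfl⟩ := hu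
      exact ⟨c • k, by simp [Finset.smul_sum, mul_smul]⟩
  · rintro ⟨k, rfl⟩
    exact sum_mem fun j hj =>
      Submodule.smul_mem _ _ (Submodule.subset_span (Set.mem_image_of_mem _ hj))

/-- `b.flip.IsPos` means positive coroot height, whereas a coroot whose negative is a nonnegative
combination of simple coroots has height at most 0. -/
lemma coroot_mem_of_isPos {P : RootPairing ι ℤ X Y} {b : P.Base} {i : ι} (hi : b.flip.IsPos i) :
    P.coroot i ∈ AddSubmonoid.closure (P.coroot '' b.support) := by
  refine (b.coroot_mem_or_neg_mem i).resolve_right fun h => ?_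
  obtain ⟨k, hk⟩ := (mem_closure_coroot_iff P b _).mp h
  have h1 : P.flip.root i = ∑ j ∈ b.flip.support, (-(k j : ℤ)) • P.flip.root j := by
    change P.coroot i = ∑ j ∈ b.support, (-(k j : ℤ)) • P.coroot j
    rw [← neg_neg (P.coroot i), hk]
    simp
  have h2 := RootPairing.Base.height_eq_sum h1
  rw [RootPairing.Base.isPos_iff, h2, Finset.sum_neg_distrib] at hi
  have : 0 ≤ ∑ j ∈ b.flip.support, (k j : ℤ) := Finset.sum_nonneg fun _ _ => by positivity
  lia

lemma dominanceLE_antisymm {P : RootPairing ι ℤ X Y} {b : P.Base} {μ ν : Y}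
    (h : DominanceLE P b ν μ) (h' : DominanceLE P b μ ν) : ν = μ := by
  obtain ⟨k, hk⟩ := (mem_closure_coroot_iff P b _).mp h
  obtain ⟨l, hl⟩ := (mem_closure_coroot_iff P b _).mp h'
  have h0 : ∑ j ∈ b.support, ((k j : ℤ) + l j) • P.coroot j = 0 := by
    simp only [add_smul, natCast_zsmul, Finset.sum_add_distrib]
    rw [← hk, ← hl]
    abel
  have h1 := linearIndepOn_finset_iff.mp b.linearIndepOn_coroot _ h0
  have h2 : μ - ν = 0 := by
    rw [hk]
    refine Finset.sum_eq_zero fun j hj => ?_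
    have := h1 j hj
    have h3 : k j = 0 := by lia
    simp [h3]
  exact (sub_eq_zero.mp h2).symm

/-! ### Words in the simple reflections -/

section Finite

variable [Finite ι] (P : RootPairing ι ℤ X Y)

lemma exists_simple_word [P.IsReduced] (b : P.Base) (w : P.weylGroup) :
    ∃ L : List ι, (∀ i ∈ L, i ∈ b.support) ∧
      (L.map (RootPairing.weylGroup.ofIdx P)).prod = w := by
  -- A submonoid suffices, since reflections are involutions, and its elements are words without
  -- inverses.
  let H : Submonoid P.weylGroup :=
    Submonoid.closure (RootPairing.weylGroup.ofIdx P '' b.support)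
  have hmem : ∀ i, RootPairing.weylGroup.ofIdx P i ∈ H := by
    intro i
    refine b.induction_reflect i (p := fun i => RootPairing.weylGroup.ofIdx P i ∈ H) ?_ ?_ ?_
    · intro i hi
      rwa [ofIdx_reflectionPerm_self]
    · exact fun i hi => Submonoid.subset_closure ⟨i, hi, rfl⟩
    · intro i j hi hj
      rw [← ofIdx_smul_eq, ofIdx_smul, ofIdx_inv]
      have hj' : RootPairing.weylGroup.ofIdx P j ∈ H := Submonoid.subset_closure ⟨j, hj, rfl⟩
      exact mul_mem (mul_mem hj' hi) hj'
  have hw : w ∈ H := by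
    obtain ⟨w, hw⟩ := w
    induction hw using RootPairing.weylGroup.induction with
    | mem i => exact hmem i
    | one => exact one_mem H
    | mul x y hx hy ihx ihy => exact mul_mem ihx ihy
  induction hw using Submonoid.closure_induction with
  | mem w hw =>
    obtain ⟨i, hi, rfl⟩ := hw
    exact ⟨[i], by simpa using hi, by simp⟩
  | one => exact ⟨[], by simp⟩
  | mul u v _ _ hu hv =>
    obtain ⟨L, hL, rfl⟩ := hu
    obtain ⟨L', hL', rfl⟩ := hv
    refine ⟨L ++ L', fun i hi => ?_, by simp⟩
    rcases List.mem_append.mp hi with hi | hi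
    exacts [hL i hi, hL' i hi]

/-- The exchange condition for words in the simple reflections. -/
lemma exists_word_length_lt [P.IsReduced] (b : P.Base) {k : ι} (hk : k ∈ b.support) (L : List ι)
    (hL : ∀ i ∈ L, i ∈ b.support)
    (h : ¬ b.flip.IsPos ((L.map (RootPairing.weylGroup.ofIdx P)).prod • k)) :
    ∃ L' : List ι, (∀ i ∈ L', i ∈ b.support) ∧ L'.length < L.length ∧
      (L'.map (RootPairing.weylGroup.ofIdx P)).prod
        = (L.map (RootPairing.weylGroup.ofIdx P)).prod * RootPairing.weylGroup.ofIdx P k := by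
  induction L with
  | nil =>
    refine absurd ?_ h
    simpa using RootPairing.Base.isPos_of_mem_support (b := b.flip) hk
  | cons i L ih =>
    have hL1 : ∀ i ∈ L, i ∈ b.support := fun i hi => hL i (List.mem_cons_of_mem _ hi)
    have hi : i ∈ b.support := hL i List.mem_cons_self
    by_cases hpos : b.flip.IsPos ((L.map (RootPairing.weylGroup.ofIdx P)).prod • k)
    · refine ⟨L, hL1, by simp, ?_⟩
      set u := (L.map (RootPairing.weylGroup.ofIdx P)).prod with hu
      -- The simple reflection `s_i` keeps every positive coroot other than the `i`-th positive.
      -- Hence `s_i = u s_k u⁻¹`, and the letter `i` cancels against the appended `k`.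
      have hui : u • k = i := by
        by_contra hne
        refine h ?_
        rw [List.map_cons, List.prod_cons, mul_smul, ofIdx_smul_eq]
        have : Module.IsReflexive ℤ X := .of_isPerfPair P.toLinearMap
        have : Module.IsReflexive ℤ Y := .of_isPerfPair P.flip.toLinearMap
        exact hpos.reflectionPerm hi hne
      have h1 := ofIdx_smul P u k
      rw [hui] at h1
      rw [List.map_cons, List.prod_cons, ← hu, h1]
      have h2 := ofIdx_mul_self P k
      rw [mul_assoc, mul_assoc, mul_assoc, inv_mul_cancel_left, h2, mul_one]
    · obtain ⟨L', hL', hlen, hprod⟩ := ih hL1 hpos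
      refine ⟨i :: L', ?_, by simpa using hlen, ?_⟩
      · intro j hj
        rcases List.mem_cons.mp hj with rfl | hj
        exacts [hi, hL' j hj]
      · simp [hprod, mul_assoc]

variable {P}

/-- Write `w = u s_k`. If `u α_k^∨` is positive, then `μ - w μ = (μ - u μ) + ⟨α_k, μ⟩ u α_k^∨` with
both terms nonnegative; otherwise the exchange condition gives a shorter word for `w`. -/
lemma weylSmul_dominanceLE [P.IsReduced] {b : P.Base} {μ : Y} (hμ : IsDominant P b μ)
    (w : P.weylGroup) : DominanceLE P b (weylSmul P w μ) μ := by
  obtain ⟨L, hL, rfl⟩ := exists_simple_word P b w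
  induction hn : L.length using Nat.strong_induction_on generalizing L with
  | _ n ih =>
    subst hn
    rcases L.eq_nil_or_concat with rfl | ⟨L, k, rfl⟩
    · simp [DominanceLE, weylSmul_one]
    · have hL1 : ∀ i ∈ L, i ∈ b.support := fun i hi => hL i (by simp [hi])
      have hk : k ∈ b.support := hL k (by simp)
      by_cases hpos : b.flip.IsPos ((L.map (RootPairing.weylGroup.ofIdx P)).prod • k)
      · have h1 := ih L.length (by simp) L hL1 rfl
        set u := (L.map (RootPairing.weylGroup.ofIdx P)).prod with hu
        obtain ⟨n, hn⟩ := Int.eq_ofNat_of_zero_le (hμ k hk)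
        have h2 : μ - weylSmul P ((L.concat k).map (RootPairing.weylGroup.ofIdx P)).prod μ
            = (μ - weylSmul P u μ) + n • P.coroot (u • k) := by
          rw [List.concat_eq_append, List.map_append, List.prod_append, ← hu]
          simp only [List.map_cons, List.map_nil, List.prod_singleton]
          rw [weylSmul_mul, weylSmul_ofIdx, weylSmul_sub, weylSmul_zsmul, weylSmul_coroot, hn,
            natCast_zsmul]
          abel
        unfold DominanceLE at h1 ⊢
        rw [h2]
        exact add_mem h1 (nsmul_mem (coroot_mem_of_isPos hpos) n)
      · obtain ⟨L', hL', hlen, hprod⟩ := exists_word_length_lt P b hk L hL1 hpos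
        have h1 := ih L'.length (by simp; lia) L' hL' rfl
        rw [hprod] at h1
        simpa using h1

lemma eq_of_isDominant_weylSmul [P.IsReduced] {b : P.Base} {μ : Y} (hμ : IsDominant P b μ)
    {w : P.weylGroup} (hw : IsDominant P b (weylSmul P w μ)) : weylSmul P w μ = μ := by
  refine dominanceLE_antisymm (weylSmul_dominanceLE hμ w) ?_
  have h := weylSmul_dominanceLE hw w⁻¹
  rwa [weylSmul_inv_weylSmul] at h

/-! ### Positive definiteness on the coroot span -/

/-- The coroot form is the sum of the squares of the roots, and it is definite on the coroot span.
-/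
lemma eq_zero_of_mem_corootSpan {v : Y} (hv : v ∈ P.corootSpan ℤ)
    (h : ∀ i, P.toLinearMap (P.root i) v = 0) : v = 0 := by
  cases nonempty_fintype ι
  refine P.flip.eq_zero_of_mem_rootSpan_of_rootForm_self_eq_zero hv ?_
  change P.CorootForm v v = 0
  rw [RootPairing.corootForm_apply_apply]
  exact Finset.sum_eq_zero fun i _ => by simp [RootPairing.root', h]

/-- Expanding `0 < (v, v) = ∑ k_j (α_j^∨, v)` gives a positive term, and `(α_i^∨, α_i^∨) ⟨α_i, v⟩ =
2 (α_i^∨, v)` turns it into a positive root value. -/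
lemma exists_pos_of_sum_ne_zero (b : P.Base) (k : ι → ℕ)
    (h : ∑ j ∈ b.support, k j • P.coroot j ≠ 0) :
    ∃ i ∈ b.support, k i ≠ 0 ∧
      0 < P.toLinearMap (P.root i) (∑ j ∈ b.support, k j • P.coroot j) := by
  cases nonempty_fintype ι
  set v := ∑ j ∈ b.support, k j • P.coroot j with hv
  have hmem : v ∈ P.corootSpan ℤ :=
    sum_mem fun j _ => nsmul_mem (Submodule.subset_span (Set.mem_range_self j)) _
  have hpos : 0 < P.CorootForm v v := P.flip.rootForm_pos_of_ne_zero hmem h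
  have hsum : P.CorootForm v v = ∑ j ∈ b.support, k j • P.CorootForm (P.coroot j) v := by
    conv_lhs => enter [1]; rw [hv]
    simp
  rw [hsum] at hpos
  obtain ⟨i, hi, hi'⟩ := Finset.exists_lt_of_sum_lt (f := fun _ => (0 : ℤ)) (by simpa using hpos)
  refine ⟨i, hi, fun h0 => by simp [h0] at hi', ?_⟩
  have h1 : 0 < P.CorootForm (P.coroot i) v := by
    exact pos_of_mul_pos_right hi' (by positivity)
  have h2 := congrArg (fun q => P.toLinearMap q v) (P.corootForm_self_smul_root i)
  simp only [map_smul, LinearMap.smul_apply, map_nsmul, RootPairing.toLinearMap_apply_CoPolarization,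
    smul_eq_mul] at h2
  have h3 : 0 ≤ P.CorootForm (P.coroot i) (P.coroot i) := P.flip.zero_le_rootForm _
  have h4 : 0 < P.CorootForm (P.coroot i) (P.coroot i) * P.toLinearMap (P.root i) v := by
    rw [h2]; positivity
  exact pos_of_mul_pos_right h4 h3

/-- To descend from `μ` to a dominant `ν ≤ μ`, it suffices to subtract simple coroots from
elements on which the corresponding root is positive. -/
lemma IsDominant.descending_induction {b : P.Base} {S : Y → Prop} {μ ν : Y}
    (hν : IsDominant P b ν) (hνμ : DominanceLE P b ν μ) (hμ : S μ)
    (step : ∀ π, ∀ i ∈ b.support, 1 ≤ P.toLinearMap (P.root i) π → S π → S (π - P.coroot i)) :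
    S ν := by
  classical
  obtain ⟨k, hk⟩ := (mem_closure_coroot_iff P b _).mp hνμ
  clear hνμ
  induction hn : ∑ j ∈ b.support, k j generalizing μ k with
  | zero =>
    have : μ - ν = 0 := by
      rw [hk]
      exact Finset.sum_eq_zero fun j hj => by rw [Finset.sum_eq_zero_iff.mp hn j hj, zero_smul]
    rwa [← sub_eq_zero.mp this]
  | succ n ih =>
    by_cases h0 : ∑ j ∈ b.support, k j • P.coroot j = 0
    · rw [h0, sub_eq_zero] at hk
      rwa [← hk]
    obtain ⟨i, hi, hki, hpos⟩ := exists_pos_of_sum_ne_zero b k h0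
    rw [← hk, map_sub] at hpos
    -- The root is positive on `μ - ν` and nonnegative on `ν`, hence at least 1 on the current `μ`,
    -- which need not be dominant.
    have hstep := step μ i hi (by have := hν i hi; lia) hμ
    have hk' : ∀ j, k j = Function.update k i (k i - 1) j + (Pi.single i 1 : ι → ℕ) j := by
      intro j
      by_cases hj : j = i
      · subst hj; simp; lia
      · simp [hj]
    refine ih hstep (Function.update k i (k i - 1)) ?_ ?_
    · rw [sub_right_comm, hk, sub_eq_iff_eq_add]
      rw [Finset.sum_congr rfl fun j _ => congrArg (· • P.coroot j) (hk' j)]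
      simp_rw [add_smul, Finset.sum_add_distrib]
      congr 1
      · rw [Finset.sum_eq_single_of_mem i hi (fun j _ hij => by simp [hij])]
        simp
    · have h1 : ∑ j ∈ b.support, k j = ∑ j ∈ b.support, Function.update k i (k i - 1) j
          + ∑ j ∈ b.support, (Pi.single i 1 : ι → ℕ) j := by
        rw [← Finset.sum_add_distrib]
        exact Finset.sum_congr rfl fun j _ => hk' j
      have h2 : ∑ j ∈ b.support, (Pi.single i 1 : ι → ℕ) j = 1 := by
        rw [Finset.sum_eq_single_of_mem i hi (fun j _ hij => by simp [hij]), Pi.single_eq_same]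
      rw [hn, h2] at h1
      lia

/-! ### Coordinates dual to the simple coroots -/

variable (P) in
/-- The value at a root, as a linear form on the apartment. -/
def rootForm (i : ι) : Apartment P →ₗ[ℝ] ℝ where
  toFun := rootVal P i
  map_add' := rootVal_add P i
  map_smul' := rootVal_smul P i

/-- A kernel vector gives a combination of simple coroots killed by all roots, which vanishes by
definiteness. -/
lemma det_pairing_ne_zero (b : P.Base) [DecidableEq b.support] :
    (Matrix.of fun i j : b.support => P.pairing i j).det ≠ 0 := by
  intro h
  obtain ⟨v, hv0, hv⟩ := Matrix.exists_mulVec_eq_zero_iff.mpr h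
  have hsum : ∑ j : b.support, v j • P.coroot j = 0 := by
    refine eq_zero_of_mem_corootSpan
      (sum_mem fun j _ => Submodule.smul_mem _ _ (Submodule.subset_span
        (Set.mem_range_self (j : ι)))) fun i => ?_
    have hi := b.root_mem_span_int i
    generalize P.root i = q at hi
    induction hi using Submodule.span_induction with
    | mem q hq =>
      obtain ⟨i, hi, rfl⟩ := hq
      have := congrFun hv ⟨i, hi⟩
      simpa [Matrix.mulVec, dotProduct, mul_comm] using this
    | zero => simp
    | add q r _ _ hq hr => rw [map_add, LinearMap.add_apply, hq, hr, add_zero]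
    | smul c q _ hq => rw [map_smul, LinearMap.smul_apply, hq, smul_zero]
  have hli : LinearIndependent ℤ (fun j : b.support => P.coroot j) := b.linearIndepOn_coroot
  exact hv0 (funext fun j => Fintype.linearIndependent_iff.mp hli v hsum j)

/-- These are the fundamental weights, obtained from the simple roots by the inverse Cartan matrix
over `ℝ`. -/
lemma exists_dual_forms (b : P.Base) [DecidableEq b.support] :
    ∃ φ : b.support → Apartment P →ₗ[ℝ] ℝ,
      ∀ j i : b.support, φ j (toApartment P (P.coroot i)) = if j = i then 1 else 0 := by
  let A : Matrix b.support b.support ℝ :=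
    (Int.castRingHom ℝ).mapMatrix (Matrix.of fun i j : b.support => P.pairing i j)
  have hA : IsUnit A.det := by
    rw [isUnit_iff_ne_zero, ← RingHom.map_det]
    simpa using det_pairing_ne_zero b
  refine ⟨fun j => ∑ k, A⁻¹ j k • rootForm P k, fun j i => ?_⟩
  have h1 : (A⁻¹ * A) j i = if j = i then 1 else 0 := by
    rw [Matrix.nonsing_inv_mul _ hA, Matrix.one_apply]
  rw [← h1, Matrix.mul_apply]
  simp only [LinearMap.sum_apply, LinearMap.smul_apply, smul_eq_mul]
  refine Finset.sum_congr rfl fun k _ => ?_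
  congr 1

/-- Every point of the apartment is conjugate under the Weyl group to a dominant one. -/
lemma exists_act_nonneg (b : P.Base) (v : Apartment P) :
    ∃ w : P.weylGroup, ∀ i ∈ b.support, 0 ≤ rootVal P i (act P (SemidirectProduct.inr w) v) := by
  classical
  obtain ⟨φ, hφ⟩ := exists_dual_forms b
  have hfin : (Set.range fun w : P.weylGroup => act P (SemidirectProduct.inr w) v).Finite := by
    refine Set.Finite.of_finite_image (f := fun u i => rootVal P i u) ?_
      fun u _ u' _ h => apartment_ext P fun i => congrFun h i
    refine (Set.Finite.pi' fun _ => Set.finite_range fun i => rootVal P i v).subset ?_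
    rintro _ ⟨_, ⟨w, rfl⟩, rfl⟩ i
    exact ⟨w⁻¹ • i, by simp [rootVal_act]⟩
  -- The sum of the fundamental weights is 1 on each simple coroot, so `s_i` changes it by
  -- `-α_i(u)`. At a maximum over the finite orbit, `α_i(u) ≥ 0`.
  obtain ⟨_, ⟨w, rfl⟩, hw⟩ := Set.exists_max_image _ (fun u => (∑ j, φ j) u) hfin ⟨_, 1, rfl⟩
  refine ⟨w, fun i hi => ?_⟩
  have h := hw _ ⟨RootPairing.weylGroup.ofIdx P i * w, rfl⟩
  set u := act P (SemidirectProduct.inr w) v with hu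
  have h1 : act P (SemidirectProduct.inr (RootPairing.weylGroup.ofIdx P i * w)) v
      = u - rootVal P i u • toApartment P (P.coroot i) := by
    rw [map_mul, act_mul, ← hu]
    have h2 : (SemidirectProduct.inr (RootPairing.weylGroup.ofIdx P i) : ExtAffineWeyl P)
        = affineReflection P i 0 := by
      simp only [affineReflection, zero_smul]
      rfl
    refine apartment_ext P fun j => ?_
    rw [h2, rootVal_act_affineReflection, rootVal_sub, rootVal_smul, rootVal_toApartment,
      RootPairing.root_coroot_eq_pairing]
    push_cast
    ring
  have h3 : (∑ j, φ j) (toApartment P (P.coroot i)) = 1 := by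
    rw [LinearMap.sum_apply]
    simp_rw [hφ _ ⟨i, hi⟩]
    simp
  simp only [] at h
  rw [h1, map_sub, map_smul, h3, smul_eq_mul, mul_one] at h
  linarith

lemma exists_isDominant_weylSmul (b : P.Base) (ν : Y) :
    ∃ w : P.weylGroup, IsDominant P b (weylSmul P w ν) := by
  obtain ⟨w, hw⟩ := exists_act_nonneg b (toApartment P ν)
  refine ⟨w, fun i hi => ?_⟩
  have h := hw i hi
  rw [act_inr_toApartment, rootVal_toApartment] at h
  exact_mod_cast h

end Finite

/-! ### The stabilizer of a special vertex and its double cosets -/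

lemma mul_transl (P : RootPairing ι ℤ X Y) (y : ExtAffineWeyl P) (ν : Y) :
    y * transl P ν = transl P (weylSmul P y.right ν) * y := by
  refine SemidirectProduct.ext ?_ ?_
  · change y.left * (weylAct P y.right) (Multiplicative.ofAdd ν)
      = (weylAct P y.right) (Multiplicative.ofAdd ν) * (weylAct P 1) y.left
    rw [map_one, mul_comm]
    rfl
  · simp [transl]

lemma transl_mul_transl (P : RootPairing ι ℤ X Y) (ν ν' : Y) :
    transl P ν * transl P ν' = transl P (ν + ν') := by
  simp only [transl, ofAdd_add, map_mul]

lemma transl_inv (P : RootPairing ι ℤ X Y) (ν : Y) : (transl P ν)⁻¹ = transl P (-ν) := by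
  simp only [transl, ofAdd_neg, map_inv]

lemma act_transl (P : RootPairing ι ℤ X Y) (ν : Y) (v : Apartment P) :
    act P (transl P ν) v = v + toApartment P ν := by
  refine apartment_ext P fun i => ?_
  rw [rootVal_act, rootVal_add, rootVal_toApartment]
  simp [transl]

lemma act_parahoricWeyl {P : RootPairing ι ℤ X Y} {x : Apartment P} {k : ExtAffineWeyl P}
    (hk : k ∈ parahoricWeyl P {x}) : act P k x = x :=
  hk.2 x rfl

lemma act_transl_mul {P : RootPairing ι ℤ X Y} {x : Apartment P} {k : ExtAffineWeyl P}
    (hk : k ∈ parahoricWeyl P {x}) (ν : Y) : act P (transl P ν * k) x = x + toApartment P ν := by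
  rw [act_mul, act_parahoricWeyl hk, act_transl]

lemma affineReflection_mem_parahoricWeyl {P : RootPairing ι ℤ X Y} {x : Apartment P} {i : ι}
    {m : ℤ} (h : rootVal P i x = m) : affineReflection P i m ∈ parahoricWeyl P {x} := by
  refine ⟨Submodule.smul_mem _ _ (Submodule.subset_span (Set.mem_range_self i)), ?_⟩
  rintro v rfl
  refine apartment_ext P fun j => ?_
  rw [rootVal_act_affineReflection, h]
  simp

/-- Specialness provides, for each root, a reflecting hyperplane through `x`, hence a lift of each
generator. -/
lemma exists_parahoricWeyl_right_eq {P : RootPairing ι ℤ X Y} {x : Apartment P}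
    (hx : IsSpecial P x) (w : P.weylGroup) : ∃ k ∈ parahoricWeyl P {x}, k.right = w := by
  obtain ⟨w, hw⟩ := w
  induction hw using RootPairing.weylGroup.induction with
  | mem i =>
    obtain ⟨m, hm⟩ := hx i
    exact ⟨_, affineReflection_mem_parahoricWeyl hm, rfl⟩
  | one => exact ⟨1, one_mem _, rfl⟩
  | mul u v hu hv ihu ihv =>
    obtain ⟨k, hk, hku⟩ := ihu
    obtain ⟨l, hl, hlv⟩ := ihv
    refine ⟨k * l, mul_mem hk hl, ?_⟩
    rw [SemidirectProduct.mul_right, hku, hlv]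
    rfl

lemma exists_eq_transl_mul {P : RootPairing ι ℤ X Y} {x : Apartment P}
    (hx : IsSpecial P x) (y : ExtAffineWeyl P) :
    ∃ ν, ∃ k ∈ parahoricWeyl P {x}, y = transl P ν * k := by
  obtain ⟨k, hk, hky⟩ := exists_parahoricWeyl_right_eq hx y.right
  refine ⟨(y * k⁻¹).left.toAdd, k, hk, ?_⟩
  rw [← mul_inv_eq_iff_eq_mul]
  refine SemidirectProduct.ext rfl ?_
  simp [transl, hky]

/-- Fixing `x` only says that all roots kill `ν`; membership in `W_a` is what excludes central
cocharacters. -/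
lemma eq_zero_of_transl_mem_parahoricWeyl [Finite ι] {P : RootPairing ι ℤ X Y} {x : Apartment P}
    {ν : Y} (h : transl P ν ∈ parahoricWeyl P {x}) : ν = 0 := by
  refine eq_zero_of_mem_corootSpan (P := P) h.1 fun i => ?_
  have h1 := act_parahoricWeyl h
  rw [act_transl] at h1
  have h2 := congrArg (rootVal P i) h1
  rw [rootVal_add, rootVal_toApartment, add_eq_left] at h2
  exact_mod_cast h2

lemma toDoubleCoset_mul {P : RootPairing ι ℤ X Y} {F : Set (Apartment P)}
    {k : ExtAffineWeyl P} (hk : k ∈ parahoricWeyl P F) (y : ExtAffineWeyl P) :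
    toDoubleCoset P F (y * k) = toDoubleCoset P F y :=
  ((DoubleCoset.eq _ _ _ _).mpr ⟨1, one_mem _, k, hk, by rw [one_mul]⟩).symm

lemma toDoubleCoset_transl_eq_iff [Finite ι] {P : RootPairing ι ℤ X Y} {x : Apartment P}
    (hx : IsSpecial P x) (ν ν' : Y) :
    toDoubleCoset P {x} (transl P ν) = toDoubleCoset P {x} (transl P ν') ↔
      ∃ w : P.weylGroup, ν' = weylSmul P w ν := by
  refine (DoubleCoset.eq _ _ _ _).trans ⟨?_, ?_⟩
  · rintro ⟨k, hk, l, hl, h⟩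
    refine ⟨k.right, ?_⟩
    rw [mul_transl, mul_assoc, ← inv_mul_eq_iff_eq_mul, transl_inv, transl_mul_transl] at h
    have h1 : transl P (-weylSmul P k.right ν + ν') ∈ parahoricWeyl P {x} := by
      rw [h]
      exact mul_mem hk hl
    have h2 := eq_zero_of_transl_mem_parahoricWeyl h1
    rwa [neg_add_eq_zero, eq_comm] at h2
  · rintro ⟨w, rfl⟩
    obtain ⟨k, hk, rfl⟩ := exists_parahoricWeyl_right_eq hx w
    refine ⟨k, hk, k⁻¹, inv_mem hk, ?_⟩
    rw [mul_transl, mul_inv_cancel_right]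

/-- Meant for `n = α_i(x)`: the reflection in `α_i = n` then fixes `x` and joins `k`. The
coefficient of the coroot is the value of `α_i - m` at `x + ν`. -/
lemma affineReflection_mul_transl (P : RootPairing ι ℤ X Y) (i : ι) (m n : ℤ) (ν : Y)
    (k : ExtAffineWeyl P) :
    affineReflection P i m * (transl P ν * k)
      = transl P (ν - (n + P.toLinearMap (P.root i) ν - m) • P.coroot i)
        * (affineReflection P i n * k) := by
  have h1 : affineReflection P i m = transl P ((m - n) • P.coroot i) * affineReflection P i n := by
    refine SemidirectProduct.ext ?_ ?_
    · change m • P.coroot i = (m - n) • P.coroot i + (weylSmul P 1 (n • P.coroot i))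
      rw [weylSmul_one, ← add_smul, sub_add_cancel]
    · exact (one_mul _).symm
  have h2 : (affineReflection P i n).right = RootPairing.weylGroup.ofIdx P i := rfl
  rw [h1, mul_assoc, ← mul_assoc (affineReflection P i n), mul_transl, h2, weylSmul_ofIdx,
    mul_assoc, ← mul_assoc, transl_mul_transl]
  congr 2
  module

/-! ### Lengths and reflections -/

/-- The affine roots that are negative at `v` and positive at `y v`. -/
def separating (P : RootPairing ι ℤ X Y) (v : Apartment P) (y : ExtAffineWeyl P) : Set (ι × ℤ) :=
  {p | rootVal P p.1 v < p.2 ∧ (p.2 : ℝ) < rootVal P p.1 (act P y v)}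

/-- An element of the group carries affine roots to affine roots, so their signs on the facet and on
its image can be read at `v` and `y v`. -/
lemma length_facet (P : RootPairing ι ℤ X Y) (v : Apartment P) (y : ExtAffineWeyl P) :
    length P (facet P v) y = (separating P v y).ncard := by
  have hself : v ∈ facet P v := fun i m => ⟨Iff.rfl, Iff.rfl⟩
  unfold length separating
  congr 1
  ext ⟨i, m⟩
  refine ⟨fun h => ⟨h.1 v hself, h.2 v hself⟩, fun h => ⟨fun u hu => (hu i m).1.mpr h.1, ?_⟩⟩
  intro u hu
  have h2 := h.2
  simp only [rootVal_act] at h2 ⊢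
  set n := P.toLinearMap (P.root i) y.left.toAdd
  obtain ⟨h3, h4⟩ := hu (y.right⁻¹ • i) (m - n)
  push_cast at h3 h4
  have h5 : ¬ rootVal P (y.right⁻¹ • i) u < m - n := fun h => by
    have := h3.mp h
    linarith
  have h6 : rootVal P (y.right⁻¹ • i) u ≠ m - n := fun h => by
    have := h4.mp h
    linarith
  have := lt_of_le_of_ne (not_lt.mp h5) h6.symm
  linarith

lemma finite_separating [Finite ι] (P : RootPairing ι ℤ X Y) (v : Apartment P)
    (y : ExtAffineWeyl P) : (separating P v y).Finite := by
  have h : separating P v y ⊆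
      ⋃ i : ι, Prod.mk i '' Set.Icc ⌊rootVal P i v⌋ ⌈rootVal P i (act P y v)⌉ := by
    rintro ⟨i, m⟩ ⟨h1, h2⟩
    refine Set.mem_iUnion.mpr ⟨i, m, ⟨?_, ?_⟩, rfl⟩
    · exact Int.cast_le.mp ((Int.floor_le _).trans h1.le)
    · exact Int.cast_le.mp (h2.le.trans (Int.le_ceil _))
  exact (Set.finite_iUnion fun i => (Set.finite_Icc _ _).image _).subset h

/-- The reflection in the hyperplane `α_i = m`, acting on affine roots. -/
def reflectAffineRoot (P : RootPairing ι ℤ X Y) (i : ι) (m : ℤ) (p : ι × ℤ) : ι × ℤ :=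
  (P.reflectionPerm i p.1, p.2 - m * P.pairing p.1 i)

lemma rootVal_reflectAffineRoot (P : RootPairing ι ℤ X Y) (i : ι) (m : ℤ) (p : ι × ℤ)
    (v : Apartment P) :
    rootVal P (reflectAffineRoot P i m p).1 v - (reflectAffineRoot P i m p).2
      = rootVal P p.1 (act P (affineReflection P i m) v) - p.2 := by
  rw [rootVal_act_affineReflection, reflectAffineRoot, rootVal_reflectionPerm]
  push_cast
  ring

lemma reflectAffineRoot_involutive (P : RootPairing ι ℤ X Y) (i : ι) (m : ℤ) :
    Function.Involutive (reflectAffineRoot P i m) := by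
  rintro ⟨j, n⟩
  have h : P.pairing (P.reflectionPerm i j) i = -P.pairing j i := by
    rw [← RootPairing.pairing_reflectionPerm, RootPairing.pairing_reflectionPerm_self_right]
  simp [reflectAffineRoot, h]

lemma act_affineReflection_eq_self (P : RootPairing ι ℤ X Y) {i : ι} {m : ℤ} {z : Apartment P}
    (hz : rootVal P i z = m) : act P (affineReflection P i m) z = z := by
  refine apartment_ext P fun j => ?_
  rw [rootVal_act_affineReflection, hz, sub_self, mul_zero, sub_zero]

lemma affineReflection_mul_self (P : RootPairing ι ℤ X Y) (i : ι) (m : ℤ) :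
    affineReflection P i m * affineReflection P i m = 1 := by
  refine SemidirectProduct.ext ?_ (ofIdx_mul_self P i)
  change m • P.coroot i + weylSmul P (RootPairing.weylGroup.ofIdx P i) (m • P.coroot i) = 0
  rw [weylSmul_zsmul, weylSmul_ofIdx, RootPairing.root_coroot_eq_pairing, RootPairing.pairing_same]
  module

/-- Let `z` be the point where the segment from `v` to `y v` meets the mirror of the reflection `s`.
An affine root separating `v` from `s y v` is kept if it is nonnegative at `z` and replaced by its
mirror image otherwise. As `s` fixes `z`, this is an injection into the affine roots separating `v`
from `y v`, and it misses `(i, m)`. -/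
lemma length_affineReflection_mul_lt [Finite ι] (P : RootPairing ι ℤ X Y) (v : Apartment P)
    (y : ExtAffineWeyl P) {i : ι} {m : ℤ} (h1 : rootVal P i v < m)
    (h2 : (m : ℝ) < rootVal P i (act P y v)) :
    length P (facet P v) (affineReflection P i m * y) < length P (facet P v) y := by
  classical
  rw [length_facet, length_facet]
  set q := act P y v with hq
  set d := rootVal P i q - rootVal P i v with hd
  have hd0 : 0 < d := by linarith
  set t := (m - rootVal P i v) / d with ht
  have ht0 : 0 < t := div_pos (by linarith) hd0
  have ht1 : t < 1 := (div_lt_one hd0).mpr (by linarith)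
  set z : Apartment P := v + t • (q - v) with hz
  have hzval : ∀ j, rootVal P j z = (1 - t) * rootVal P j v + t * rootVal P j q := by
    intro j
    rw [hz, rootVal_add, rootVal_smul, rootVal_sub]
    ring
  have hzi : rootVal P i z = m := by
    rw [hz, rootVal_add, rootVal_smul, rootVal_sub, ← hd, ht, div_mul_cancel₀ _ hd0.ne']
    ring
  have hmem : (i, m) ∈ separating P v y := ⟨h1, h2⟩
  refine lt_of_le_of_lt ?_ (Set.ncard_sdiff_singleton_lt_of_mem hmem (finite_separating P v y))
  let s := reflectAffineRoot P i m
  have hsz : ∀ p : ι × ℤ, rootVal P (s p).1 z - (s p).2 = rootVal P p.1 z - p.2 := by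
    intro p
    rw [rootVal_reflectAffineRoot, act_affineReflection_eq_self P hzi]
  refine Set.ncard_le_ncard_of_injOn
    (fun p => if 0 ≤ rootVal P p.1 z - p.2 then p else s p) ?_ ?_
    ((finite_separating P v y).subset Set.sdiff_subset)
  · intro p hp
    obtain ⟨hp1, hp2⟩ := hp
    rw [act_mul, ← hq] at hp2
    have hpim : p ≠ (i, m) := by
      rintro rfl
      simp only [rootVal_act_affineReflection, RootPairing.pairing_same] at hp2
      push_cast at hp2
      linarith
    by_cases hpz : 0 ≤ rootVal P p.1 z - p.2
    · simp only [hpz, if_true]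
      refine ⟨⟨hp1, ?_⟩, hpim⟩
      rw [hzval] at hpz
      have h3 : (1 - t) * (p.2 - rootVal P p.1 v) > 0 :=
        mul_pos (by linarith) (by linarith)
      have h4 : 0 < t * (rootVal P p.1 q - p.2) := by linarith
      have := pos_of_mul_pos_right h4 ht0.le
      linarith
    · simp only [hpz, if_false]
      have h5 : rootVal P (s p).1 q - (s p).2 > 0 := by
        rw [rootVal_reflectAffineRoot]
        linarith
      -- The mirror image is negative at `z` and positive at `q`, hence negative at `v`; it is not
      -- `(i, m)`, which vanishes at `z`.
      refine ⟨⟨?_, by linarith⟩, fun h => ?_⟩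
      · rw [← hsz, hzval] at hpz
        have h3 : t * (rootVal P (s p).1 q - (s p).2) > 0 := mul_pos ht0 h5
        have h4 : 0 < (1 - t) * ((s p).2 - rootVal P (s p).1 v) := by linarith
        have := pos_of_mul_pos_right h4 (by linarith)
        linarith
      · rw [← hsz, Set.mem_singleton_iff.mp h] at hpz
        simp only [hzi, sub_self, le_refl, not_true] at hpz
  · intro p hp p' hp' hpp
    by_cases hpz : 0 ≤ rootVal P p.1 z - p.2 <;> by_cases hpz' : 0 ≤ rootVal P p'.1 z - p'.2
    · simpa [hpz, hpz'] using hpp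
    · simp only [hpz, hpz', if_true, if_false] at hpp
      rw [hpp, hsz] at hpz
      exact absurd hpz hpz'
    · simp only [hpz, hpz', if_true, if_false] at hpp
      rw [← hpp, hsz] at hpz'
      exact absurd hpz' hpz
    · simp only [hpz, hpz', if_false] at hpp
      exact (reflectAffineRoot_involutive P i m).injective hpp

lemma rootVal_act_ne {P : RootPairing ι ℤ X Y} {v : Apartment P}
    (hv : ∀ (i : ι) (m : ℤ), rootVal P i v ≠ m) (y : ExtAffineWeyl P) (i : ι) (m : ℤ) :
    rootVal P i (act P y v) ≠ m := by
  rw [rootVal_act]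
  intro h
  refine hv (y.right⁻¹ • i) (m - P.toLinearMap (P.root i) y.left.toAdd) ?_
  push_cast
  linarith

/-- Otherwise the hyperplane would separate `v` from `s y v`, and the previous inequality applied to
`s y` would give `ℓ(y) < ℓ(s y)`. -/
lemma lt_rootVal_act_of_length_lt [Finite ι] {P : RootPairing ι ℤ X Y} {v : Apartment P}
    (hv : ∀ (i : ι) (m : ℤ), rootVal P i v ≠ m) {y : ExtAffineWeyl P} {i : ι} {m : ℤ}
    (h1 : rootVal P i v < m)
    (h2 : length P (facet P v) (affineReflection P i m * y) < length P (facet P v) y) :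
    (m : ℝ) < rootVal P i (act P y v) := by
  by_contra h3
  have h4 := lt_of_le_of_ne (not_lt.mp h3) (rootVal_act_ne hv y i m)
  have h5 := length_affineReflection_mul_lt P v (affineReflection P i m * y) h1 (by
    rw [act_mul, rootVal_act_affineReflection, RootPairing.pairing_same]
    push_cast
    linarith)
  rw [← mul_assoc, affineReflection_mul_self, one_mul] at h5
  exact lt_asymm h2 h5

/-! ### Points in the closure of an alcove -/

lemma rootVal_act_le_of_lt {P : RootPairing ι ℤ X Y} {v x : Apartment P}
    (hx : x ∈ closedAlcove P (facet P v)) (y : ExtAffineWeyl P) {i : ι} {m : ℤ}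
    (h : rootVal P i (act P y v) < m) : rootVal P i (act P y x) ≤ m := by
  rw [rootVal_act] at h ⊢
  have h1 := hx (y.right⁻¹ • i) (m - P.toLinearMap (P.root i) y.left.toAdd) ?_
  · push_cast at h1
    linarith
  · intro u hu
    refine ((hu _ _).1.mpr ?_).le
    push_cast
    linarith

lemma le_rootVal_act_of_lt {P : RootPairing ι ℤ X Y} {v x : Apartment P}
    (hx : x ∈ closedAlcove P (facet P v)) (y : ExtAffineWeyl P) {i : ι} {m : ℤ}
    (h : (m : ℝ) < rootVal P i (act P y v)) : (m : ℝ) ≤ rootVal P i (act P y x) := by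
  have h1 := rootVal_act_le_of_lt hx y (i := P.reflectionPerm i i) (m := -m) (by
    rw [rootVal_reflectionPerm_self]
    push_cast
    linarith)
  rw [rootVal_reflectionPerm_self] at h1
  push_cast at h1
  linarith

lemma rootVal_le_of_lt {P : RootPairing ι ℤ X Y} {v x : Apartment P}
    (hx : x ∈ closedAlcove P (facet P v)) {i : ι} {m : ℤ}
    (h : rootVal P i v < m) : rootVal P i x ≤ m := by
  have h1 := rootVal_act_le_of_lt hx 1 (i := i) (m := m)
  rw [act_one, act_one] at h1
  exact h1 h

/-! ### Weyl orbits and their convex hulls -/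

lemma mem_weylOrbit_self (P : RootPairing ι ℤ X Y) (μ : Y) : μ ∈ weylOrbit P μ :=
  ⟨1, (weylSmul_one P μ).symm⟩

lemma weylSmul_mem_weylOrbit {P : RootPairing ι ℤ X Y} {μ ν : Y} (h : ν ∈ weylOrbit P μ)
    (w : P.weylGroup) : weylSmul P w ν ∈ weylOrbit P μ := by
  obtain ⟨u, rfl⟩ := h
  exact ⟨w * u, (weylSmul_mul P w u μ).symm⟩

lemma isLinearMap_act_inr (P : RootPairing ι ℤ X Y) (w : P.weylGroup) :
    IsLinearMap ℝ (act P (SemidirectProduct.inr w)) where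
  map_add u v := apartment_ext P fun i => by simp [rootVal_act, rootVal_add]
  map_smul c v := apartment_ext P fun i => by simp [rootVal_act, rootVal_smul]

lemma toApartment_weylSmul_mem_orbitHull {P : RootPairing ι ℤ X Y} {μ ν : Y}
    (h : toApartment P ν ∈ orbitHull P μ) (w : P.weylGroup) :
    toApartment P (weylSmul P w ν) ∈ orbitHull P μ := by
  rw [← act_inr_toApartment]
  refine convexHull_min (t := act P (SemidirectProduct.inr w) ⁻¹' orbitHull P μ) ?_
    ((convex_convexHull ℝ _).is_linear_preimage (isLinearMap_act_inr P w)) h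
  rintro _ ⟨π, hπ, rfl⟩
  rw [Set.mem_preimage, act_inr_toApartment]
  exact subset_convexHull ℝ _ ⟨_, weylSmul_mem_weylOrbit hπ w, rfl⟩

lemma toApartment_mem_orbitHull_of_dominanceLE [Finite ι] {P : RootPairing ι ℤ X Y} {b : P.Base}
    {μ ν : Y} (hν : IsDominant P b ν) (h : DominanceLE P b ν μ) :
    toApartment P ν ∈ orbitHull P μ := by
  refine hν.descending_induction (S := fun π => toApartment P π ∈ orbitHull P μ) h
    (subset_convexHull ℝ _ ⟨μ, mem_weylOrbit_self P μ, rfl⟩) fun π i _ hπi hπ => ?_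
  have h1 := toApartment_weylSmul_mem_orbitHull hπ (RootPairing.weylGroup.ofIdx P i)
  rw [weylSmul_ofIdx] at h1
  set n := P.toLinearMap (P.root i) π with hn
  have hn0 : (1 : ℝ) ≤ n := by exact_mod_cast hπi
  -- Since `n ≥ 1`, the point `π - α_i^∨` lies on the segment from `π` to `s_i π = π - n α_i^∨`.
  have h2 : toApartment P (π - P.coroot i)
      = (1 - (n : ℝ)⁻¹) • toApartment P π + (n : ℝ)⁻¹ • toApartment P (π - n • P.coroot i) := by
    rw [toApartment_sub, toApartment_sub, toApartment_zsmul, smul_sub, smul_smul,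
      inv_mul_cancel₀ (by positivity)]
    module
  rw [h2]
  exact convex_convexHull ℝ _ hπ h1 (sub_nonneg.mpr (inv_le_one_of_one_le₀ hn0)) (by positivity)
    (by ring)

/-- Each half-space `φ j ≤ φ j μ` contains the orbit, because `w μ ≤ μ`, and therefore its hull. The
`φ j (μ - ν)` are the coefficients of `μ - ν`, integral by `hspan`. -/
lemma dominanceLE_of_toApartment_mem_orbitHull [Finite ι] {P : RootPairing ι ℤ X Y}
    [P.IsReduced] {b : P.Base} {μ ν : Y} (hμ : IsDominant P b μ) (hspan : μ - ν ∈ P.corootSpan ℤ)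
    (h : toApartment P ν ∈ orbitHull P μ) : DominanceLE P b ν μ := by
  classical
  obtain ⟨φ, hφ⟩ := exists_dual_forms b
  have hφsum : ∀ (j : b.support) (k : ι → ℤ),
      φ j (toApartment P (∑ i ∈ b.support, k i • P.coroot i)) = k j := by
    intro j k
    have h1 : toApartment P (∑ i ∈ b.support, k i • P.coroot i)
        = ∑ i : b.support, (k i : ℝ) • toApartment P (P.coroot i) := by
      rw [← Finset.sum_coe_sort]
      simp_rw [← toApartment_zsmul]
      exact map_sum (AddMonoidHom.mk' (toApartment P) (toApartment_add P)) _ _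
    rw [h1, map_sum]
    simp_rw [map_smul, hφ]
    simp
  have hle : ∀ j, φ j (toApartment P ν) ≤ φ j (toApartment P μ) := by
    intro j
    refine convexHull_min (t := {v | φ j v ≤ φ j (toApartment P μ)}) ?_
      (convex_halfSpace_le (φ j).isLinear _) h
    rintro _ ⟨_, ⟨w, rfl⟩, rfl⟩
    obtain ⟨k, hk⟩ := (mem_closure_coroot_iff P b _).mp (weylSmul_dominanceLE hμ w)
    have h1 := hφsum j (fun i => k i)
    simp only [natCast_zsmul] at h1
    rw [← hk, toApartment_sub, map_sub] at h1
    have h2 : (0 : ℝ) ≤ ((k j : ℤ) : ℝ) := by positivity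
    rw [Set.mem_ofPred_eq]
    linarith
  obtain ⟨k, hk⟩ := (mem_corootSpan_iff P b _).mp hspan
  refine (mem_closure_coroot_iff P b _).mpr ⟨fun i => (k i).toNat, hk.trans ?_⟩
  refine Finset.sum_congr rfl fun i hi => ?_
  have h1 := hφsum ⟨i, hi⟩ k
  rw [← hk, toApartment_sub, map_sub] at h1
  have h2 : (0 : ℝ) ≤ k i := by
    rw [← h1]
    exact sub_nonneg.mpr (hle _)
  rw [← natCast_zsmul, Int.toNat_of_nonneg (by exact_mod_cast h2)]

/-! ### Reflections and saturated sets -/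

/-- The element lies on the root string from `w ν` to `w s_i ν`. According to the sign of the coroot
`w α_i^∨`, it is below the first or the second endpoint. -/
lemma weylSmul_sub_zsmul_coroot_dominanceLE {P : RootPairing ι ℤ X Y} {b : P.Base} {μ ν : Y}
    (h : ∀ w : P.weylGroup, DominanceLE P b (weylSmul P w ν) μ) {i : ι} {k : ℤ} (hk : 0 ≤ k)
    (hkn : k ≤ P.toLinearMap (P.root i) ν) (w : P.weylGroup) :
    DominanceLE P b (weylSmul P w (ν - k • P.coroot i)) μ := by
  obtain ⟨m, rfl⟩ := Int.eq_ofNat_of_zero_le hk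
  obtain ⟨n, hn⟩ := Int.eq_ofNat_of_zero_le (sub_nonneg.mpr hkn)
  rcases b.coroot_mem_or_neg_mem (w • i) with hw | hw
  · have h1 := add_mem (h w) (nsmul_mem hw m)
    unfold DominanceLE
    convert h1 using 1
    rw [weylSmul_sub, weylSmul_zsmul, weylSmul_coroot, natCast_zsmul]
    abel
  · have h1 := add_mem (h (w * RootPairing.weylGroup.ofIdx P i)) (nsmul_mem hw n)
    unfold DominanceLE
    convert h1 using 1
    rw [weylSmul_mul, weylSmul_ofIdx, weylSmul_sub, weylSmul_sub, weylSmul_zsmul, weylSmul_zsmul,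
      weylSmul_coroot, sub_eq_iff_eq_add.mp hn, ← natCast_zsmul _ n]
    module

/-! ### Dominant representatives and Bruhat descents -/

lemma exists_isDominant_toDoubleCoset_eq [Finite ι] {P : RootPairing ι ℤ X Y} (b : P.Base)
    {x : Apartment P} (hx : IsSpecial P x) (ν : Y) :
    ∃ w : P.weylGroup, IsDominant P b (weylSmul P w ν) ∧
      toDoubleCoset P {x} (transl P ν) = toDoubleCoset P {x} (transl P (weylSmul P w ν)) := by
  obtain ⟨w, hw⟩ := exists_isDominant_weylSmul b ν
  exact ⟨w, hw, (toDoubleCoset_transl_eq_iff hx _ _).mpr ⟨w, rfl⟩⟩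

lemma bijective_toDoubleCoset_transl [Finite ι] {P : RootPairing ι ℤ X Y} [P.IsReduced]
    (b : P.Base) {x : Apartment P} (hx : IsSpecial P x) :
    Function.Bijective (fun ν : {ν : Y // IsDominant P b ν} =>
      toDoubleCoset P {x} (transl P ν)) := by
  constructor
  · rintro ⟨ν, hν⟩ ⟨ν', hν'⟩ h
    obtain ⟨w, rfl⟩ := (toDoubleCoset_transl_eq_iff hx _ _).mp h
    exact Subtype.ext (eq_of_isDominant_weylSmul hν hν').symm
  · intro c
    obtain ⟨y, rfl⟩ := Quotient.exists_rep c
    obtain ⟨ν, k, hk, rfl⟩ := exists_eq_transl_mul hx y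
    obtain ⟨w, hw, h⟩ := exists_isDominant_toDoubleCoset_eq b hx ν
    exact ⟨⟨_, hw⟩, h.symm.trans (toDoubleCoset_mul hk _).symm⟩

lemma exists_of_bruhat_step [Finite ι] {P : RootPairing ι ℤ X Y} {b : P.Base} {v x : Apartment P}
    (hv : ∀ (i : ι) (m : ℤ), rootVal P i v ≠ m) (hx : IsSpecial P x)
    (hxv : x ∈ closedAlcove P (facet P v)) {μ ν : Y}
    (hν : ∀ w : P.weylGroup, DominanceLE P b (weylSmul P w ν) μ) {k : ExtAffineWeyl P}
    (hk : k ∈ parahoricWeyl P {x}) (i : ι) (m : ℤ)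
    (hlen : length P (facet P v) (affineReflection P i m * (transl P ν * k))
      < length P (facet P v) (transl P ν * k)) :
    ∃ ν' : Y, (∀ w : P.weylGroup, DominanceLE P b (weylSmul P w ν') μ) ∧
      ∃ k' ∈ parahoricWeyl P {x},
        affineReflection P i m * (transl P ν * k) = transl P ν' * k' := by
  -- Negating the root and `m` gives the same reflection, and `v` lies on no hyperplane.
  wlog hm : rootVal P i v < m generalizing i m
  · have h1 := this (P.reflectionPerm i i) (-m)
    rw [affineReflection_reflectionPerm_self, rootVal_reflectionPerm_self] at h1
    refine h1 hlen ?_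
    push_cast
    exact neg_lt_neg (lt_of_le_of_ne (not_lt.mp hm) (hv i m).symm)
  obtain ⟨n, hn⟩ := hx i
  have h1 := lt_rootVal_act_of_length_lt hv hm hlen
  have h2 := le_rootVal_act_of_lt hxv _ h1
  have h3 := rootVal_le_of_lt hxv hm
  rw [act_transl_mul hk, rootVal_add, rootVal_toApartment, hn] at h2
  rw [hn] at h3
  norm_cast at h2 h3
  rw [affineReflection_mul_transl P i m n]
  exact ⟨_, weylSmul_sub_zsmul_coroot_dominanceLE hν (by lia) (by lia), _,
    mul_mem (affineReflection_mem_parahoricWeyl hn) hk, rfl⟩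

lemma exists_bruhatLE_of_dominanceLE [Finite ι] {P : RootPairing ι ℤ X Y} {b : P.Base}
    {v x : Apartment P} (hv : ∀ (i : ι) (m : ℤ), rootVal P i v ≠ m) (hx : IsSpecial P x)
    (hxv : x ∈ closedAlcove P (facet P v)) {μ ν : Y} (hν : IsDominant P b ν)
    (h : DominanceLE P b ν μ) :
    ∃ u : P.weylGroup, ∃ k ∈ parahoricWeyl P {x},
      BruhatLE P (facet P v) (transl P (weylSmul P u ν) * k) (transl P (weylSmul P u μ)) := by
  -- This puts `v` in the antidominant chamber at `x` for the simple roots `w⁻¹ • i`; the whole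
  -- chain from `μ` to `ν` is conjugated by `w⁻¹`.
  obtain ⟨w, hw⟩ := exists_act_nonneg b (x - v)
  refine ⟨w⁻¹, ?_⟩
  refine hν.descending_induction (S := fun π => ∃ k ∈ parahoricWeyl P {x},
    BruhatLE P (facet P v) (transl P (weylSmul P w⁻¹ π) * k) (transl P (weylSmul P w⁻¹ μ))) h
    ⟨1, one_mem _, by rw [mul_one]; exact Relation.ReflTransGen.refl⟩ ?_
  rintro π i hi hπi ⟨k, hk, hle⟩
  set j := w⁻¹ • i with hj
  obtain ⟨n, hn⟩ := hx j
  have hpair : P.toLinearMap (P.root j) (weylSmul P w⁻¹ π) = P.toLinearMap (P.root i) π :=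
    toLinearMap_root_smul P w⁻¹ i π
  set p := P.toLinearMap (P.root i) π with hp
  have hvj : rootVal P j v ≤ n := by
    have h1 := hw i hi
    rw [rootVal_act] at h1
    simp only [SemidirectProduct.right_inr, SemidirectProduct.left_inr, toAdd_one, map_zero,
      Int.cast_zero, add_zero, ← hj, rootVal_sub, hn] at h1
    linarith
  -- The level `n + p - 1` is one below the value `n + p` of the root at the image of `x`, so
  -- reflecting subtracts exactly one coroot. It is at least `n`, because `p ≥ 1`.
  have h1 : rootVal P j v < (n + p - 1 : ℤ) := by
    have h2 : rootVal P j v < n := lt_of_le_of_ne hvj (hv j n)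
    have h3 : (n : ℝ) ≤ (n + p - 1 : ℤ) := by
      norm_cast
      lia
    exact h2.trans_le h3
  have h2 : ((n + p - 1 : ℤ) : ℝ) < rootVal P j (act P (transl P (weylSmul P w⁻¹ π) * k) v) := by
    by_contra h3
    have h4 := lt_of_le_of_ne (not_lt.mp h3) (rootVal_act_ne hv _ _ _)
    have h5 := rootVal_act_le_of_lt hxv _ h4
    rw [act_transl_mul hk, rootVal_add, rootVal_toApartment, hn, hpair] at h5
    norm_cast at h5
    lia
  have h3 := length_affineReflection_mul_lt P v _ h1 h2
  have h4 := affineReflection_mul_transl P j (n + p - 1) n (weylSmul P w⁻¹ π) k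
  rw [hpair, show n + p - (n + p - 1) = 1 by ring, one_smul, hj, ← weylSmul_coroot,
    ← weylSmul_sub, ← hj] at h4
  refine ⟨_, mul_mem (affineReflection_mem_parahoricWeyl hn) hk, ?_⟩
  rw [← h4]
  exact Relation.ReflTransGen.head ⟨⟨j, _, rfl⟩, h3⟩ hle

/-! ### The admissible and permissible sets -/

lemma adm_eq [Finite ι] {P : RootPairing ι ℤ X Y} [P.IsReduced] {b : P.Base} {v x : Apartment P}
    (hv : ∀ (i : ι) (m : ℤ), rootVal P i v ≠ m) (hx : IsSpecial P x)
    (hxv : x ∈ closedAlcove P (facet P v)) {μ : Y} (hμ : IsDominant P b μ) :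
    Adm P (facet P v) {x} μ = (fun ν => toDoubleCoset P {x} (transl P ν)) ''
      {ν : Y | IsDominant P b ν ∧ DominanceLE P b ν μ} := by
  ext c
  constructor
  · rintro ⟨_, ⟨w₀, rfl⟩, z, y, rfl, hy, hzy⟩
    -- This is the invariant carried down the Bruhat chain; asking it of all conjugates makes it
    -- independent of the representative.
    suffices h : ∃ ν : Y, (∀ w : P.weylGroup, DominanceLE P b (weylSmul P w ν) μ) ∧
        ∃ k ∈ parahoricWeyl P {x}, z = transl P ν * k by
      obtain ⟨ν, hν, k, hk, rfl⟩ := h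
      obtain ⟨w, hw, hc⟩ := exists_isDominant_toDoubleCoset_eq b hx ν
      exact ⟨_, ⟨hw, hν w⟩, hc.symm.trans (toDoubleCoset_mul hk _).symm⟩
    induction hzy using Relation.ReflTransGen.head_induction_on with
    | refl =>
      obtain ⟨ν, k, hk, rfl⟩ := exists_eq_transl_mul hx y
      rw [toDoubleCoset_mul hk, eq_comm] at hy
      obtain ⟨w₁, rfl⟩ := (toDoubleCoset_transl_eq_iff hx _ _).mp hy
      refine ⟨_, fun w => ?_, k, hk, rfl⟩
      rw [← weylSmul_mul, ← weylSmul_mul]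
      exact weylSmul_dominanceLE hμ _
    | head h _ ih =>
      obtain ⟨ν, hν, k, hk, rfl⟩ := ih
      obtain ⟨⟨i, m, rfl⟩, hlen⟩ := h
      exact exists_of_bruhat_step hv hx hxv hν hk i m hlen
  · rintro ⟨ν, ⟨hν, hνμ⟩, rfl⟩
    obtain ⟨u, k, hk, h⟩ := exists_bruhatLE_of_dominanceLE hv hx hxv hν hνμ
    refine ⟨_, ⟨u, rfl⟩, _, _, ?_, rfl, h⟩
    rw [toDoubleCoset_mul hk]
    exact ((toDoubleCoset_transl_eq_iff hx _ _).mpr ⟨u, rfl⟩).symm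

lemma transl_mem_affineWeyl_iff (P : RootPairing ι ℤ X Y) (ν : Y) :
    transl P ν ∈ affineWeyl P ↔ ν ∈ P.corootSpan ℤ := Iff.rfl

lemma perm_eq [Finite ι] {P : RootPairing ι ℤ X Y} [P.IsReduced] {b : P.Base} {x : Apartment P}
    (hx : IsSpecial P x) {μ : Y} (hμ : IsDominant P b μ) :
    Perm P {x} μ = (fun ν => toDoubleCoset P {x} (transl P ν)) ''
      {ν : Y | IsDominant P b ν ∧ DominanceLE P b ν μ} := by
  ext c
  constructor
  · rintro ⟨y, rfl, hyμ, hy⟩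
    obtain ⟨ν, k, hk, rfl⟩ := exists_eq_transl_mul hx y
    have h1 := hy x rfl
    rw [act_transl_mul hk, add_sub_cancel_left] at h1
    rw [transl_inv, mul_assoc, mul_transl, ← mul_assoc, transl_mul_transl,
      Subgroup.mul_mem_cancel_right _ hk.1, transl_mem_affineWeyl_iff, weylSmul_neg] at hyμ
    obtain ⟨w, hw, hc⟩ := exists_isDominant_toDoubleCoset_eq b hx ν
    refine ⟨_, ⟨hw, ?_⟩, hc.symm.trans (toDoubleCoset_mul hk _).symm⟩
    refine dominanceLE_of_toApartment_mem_orbitHull hμ ?_ (toApartment_weylSmul_mem_orbitHull h1 w)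
    -- Modulo the coroot lattice `W` acts trivially, so `μ - w ν` is congruent to `μ - ν`, hence to
    -- 0.
    have h2 := sub_mem (neg_mem hyμ)
      (add_mem (weylSmul_sub_mem P k.right μ) (weylSmul_sub_mem P w ν))
    convert h2 using 1
    abel
  · rintro ⟨ν, ⟨hν, hνμ⟩, rfl⟩
    refine ⟨_, rfl, ?_, ?_⟩
    · rw [transl_inv, transl_mul_transl, transl_mem_affineWeyl_iff, ← neg_mem_iff]
      obtain ⟨k, hk⟩ := (mem_closure_coroot_iff P b _).mp hνμ
      refine (mem_corootSpan_iff P b _).mpr ⟨fun i => k i, ?_⟩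
      simp only [natCast_zsmul, ← hk]
      abel
    · rintro _ rfl
      rw [act_transl, add_sub_cancel_left]
      exact toApartment_mem_orbitHull_of_dominanceLE hν hνμ

/-- A positive root value on the orbit is exactly 1, so subtracting the coroot is the reflection
itself and the descent never leaves the orbit, whose only dominant element is `μ`. -/
lemma IsMinuscule.eq_of_dominanceLE [Finite ι] {P : RootPairing ι ℤ X Y} [P.IsReduced]
    {b : P.Base} {μ ν : Y} (hmin : IsMinuscule P μ) (hμ : IsDominant P b μ)
    (hν : IsDominant P b ν) (h : DominanceLE P b ν μ) : ν = μ := by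
  have h1 : ν ∈ weylOrbit P μ := by
    refine hν.descending_induction (S := fun π => π ∈ weylOrbit P μ) h (mem_weylOrbit_self P μ)
      fun π i _ hπi hπ => ?_
    have h2 := weylSmul_mem_weylOrbit hπ (RootPairing.weylGroup.ofIdx P i)
    obtain ⟨w, rfl⟩ := hπ
    have h3 : P.toLinearMap (P.root i) (weylSmul P w μ) = 1 := by
      rw [toLinearMap_root_weylSmul] at hπi ⊢
      have := hmin (w⁻¹ • i)
      simp only [Set.mem_insert_iff, Set.mem_singleton_iff] at this
      lia
    rwa [weylSmul_ofIdx, h3, one_smul] at h2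
  obtain ⟨w, rfl⟩ := h1
  exact eq_of_isDominant_weylSmul hμ hν

end

end IwahoriWeyl

theorem proposition3p11 {ι X Y : Type*} [Finite ι]
    [AddCommGroup X] [Module.Finite ℤ X] [AddCommGroup Y] [Module.Finite ℤ Y]
    (P : RootDatum ι X Y) [P.IsReduced]
    (a : Set (IwahoriWeyl.Apartment P)) (ha : IwahoriWeyl.IsAlcove P a)
    (x : IwahoriWeyl.Apartment P) (hx : IwahoriWeyl.IsSpecial P x)
    (hxa : x ∈ IwahoriWeyl.closedAlcove P a)
    (b : P.Base) (μ : Y) (hμ : IwahoriWeyl.IsDominant P b μ) :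
    Function.Bijective
      (fun ν : {ν : Y // IwahoriWeyl.IsDominant P b ν} =>
        IwahoriWeyl.toDoubleCoset P {x} (IwahoriWeyl.transl P ν)) ∧
    IwahoriWeyl.Adm P a {x} μ =
      (fun ν => IwahoriWeyl.toDoubleCoset P {x} (IwahoriWeyl.transl P ν)) ''
        {ν : Y | IwahoriWeyl.IsDominant P b ν ∧ IwahoriWeyl.DominanceLE P b ν μ} ∧
    IwahoriWeyl.Perm P {x} μ =
      (fun ν => IwahoriWeyl.toDoubleCoset P {x} (IwahoriWeyl.transl P ν)) ''
        {ν : Y | IwahoriWeyl.IsDominant P b ν ∧ IwahoriWeyl.DominanceLE P b ν μ} ∧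
    (IwahoriWeyl.IsMinuscule P μ →
      IwahoriWeyl.Adm P a {x} μ =
        {IwahoriWeyl.toDoubleCoset P {x} (IwahoriWeyl.transl P μ)}) := by
  obtain ⟨v, hv, rfl⟩ := ha
  have hadm := IwahoriWeyl.adm_eq hv hx hxa hμ
  refine ⟨IwahoriWeyl.bijective_toDoubleCoset_transl b hx, hadm, IwahoriWeyl.perm_eq hx hμ,
    fun hmin => ?_⟩
  have hset : {ν : Y | IwahoriWeyl.IsDominant P b ν ∧ IwahoriWeyl.DominanceLE P b ν μ} = {μ} := by
    ext ν
    refine ⟨fun h => hmin.eq_of_dominanceLE hμ h.1 h.2, ?_⟩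
    rintro rfl
    exact ⟨hμ, by simp [IwahoriWeyl.DominanceLE]⟩
  rw [hadm, hset, Set.image_singleton]
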